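/- Let $H$ be a real separable Hilbert space with norm $|\cdot|$ and inner product $\langle\cdot,\cdot\rangle$. Let $(U(t,s))_{t\ge s}$, $s,t\in\mathbb R$, be an evolution family of bounded linear operators on $H$, i.e. $U(s,s)=I$, $U(t,r)U(r,s)=U(t,s)$ for $t\ge r\ge s$, and $(t,s)\mapsto U(t,s)x$ is continuous on $\{t\ge s\}$ for every $x\in H$. Let $(\mu_{t,s})_{t\ge s}$ be Borel probability measures on $H$ with $$\mu_{t,s}=\mu_{t,r}*\bigl(\mu_{r,s}\circ U(t,r)^{-1}\bigr),\qquad t\ge r\ge s.$$ Assume that every $\mu_{t,s}$ is infinitely divisible with characteristic triplet $[a_{t,s},R_{t,s},m_{t,s}]$, i.e. $\int_H e^{i\langle x,\xi\rangle}\,\mu_{t,s}(dx)=e^{-\psi_{t,s}(\xi)}$ for all $\xi\in H$, with $$\psi_{t,s}(\xi)=-i\langle a_{t,s},\xi\rangle+\tfrac12\langle\xi,R_{t,s}\xi\rangle-\int_H\Bigl(e^{i\langle\xi,x\rangle}-1-\frac{i\langle\xi,x\rangle}{1+|x|^2}\Bigr)m_{t,s}(dx),$$ where $a_{t,s}\in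 H$, $R_{t,s}$ is a positive (self-adjoint) trace class operator on $H$, and $m_{t,s}$ is a Lévy measure on $H$, i.e. $m_{t,s}(\{0\})=0$ and $\int_H \min(1,|x|^2)\,m_{t,s}(dx)<\infty$. Define $$p_{s,t}f(x)=\int_H f(U(t,s)x+y)\,\mu_{t,s}(dy).$$ Let $\Gamma_{t,s}=R_{t,s}^{-1/2}U(t,s)$ with domain $\mathscr D(\Gamma_{t,s})=\{x\in H: U(t,s)x\in R_{t,s}^{1/2}(H)\}$, where $R_{t,s}^{1/2}$ is the positive square root and $R_{t,s}^{-1/2}$ its pseudo-inverse (for $h\in R_{t,s}^{1/2}(H)$, $R_{t,s}^{-1/2}h$ is the unique $g\perp\ker R_{t,s}^{1/2}$ with $R_{t,s}^{1/2}g=h$), and put $|\Gamma_{t,s}x|=\infty$ for $x\notin\mathscr D(\Gamma_{t,s})$. Then for every $\alpha>1$, all $t\ge s$, every bounded Borel measurable $f:H\to[0,\infty)$ and all $x,y\in H$, $$\bigl(p_{s,t}f(x)\bigr)^\alpha\le\exp\left(\frac{\alpha\,|\Gamma_{t,s}(x-y)|^2}{2(\alpha-1)}\right)p_{s,t}f^\alpha(y),$$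 where the right-hand side is understood as $+\infty$ when $|\Gamma_{t,s}(x-y)|=\infty$ (even if $p_{s,t}f^\alpha(y)=0$). -/

import Mathlib

open MeasureTheory
open scoped InnerProductSpace ENNReal

noncomputable section

namespace Mehler

section Operators

variable {H : Type*} [NormedAddCommGroup H] [InnerProductSpace ℝ H]

/-- A positive operator is trace class if `∑ ⟪R e, e⟫ < ∞` for every orthonormal basis. -/
structure IsPositiveTraceClass [CompleteSpace H] (R : H →L[ℝ] H) : Prop where
  isPositive : R.IsPositive
  summable_trace : ∀ (w : Set H) (b : HilbertBasis w ℝ H), Summable fun i => ⟪R (b i), b i⟫_ℝ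

/-- Polynomials with nonnegative coefficients that approximate `1 - √(1 - X)`. -/
def sqrtPoly : ℕ → Polynomial ℝ
  | 0 => 0
  | n + 1 => Polynomial.C (1 / 2) * (Polynomial.X + sqrtPoly n ^ 2)

lemma coeff_mul_nonneg {P Q : Polynomial ℝ} (hP : ∀ k, 0 ≤ P.coeff k)
    (hQ : ∀ k, 0 ≤ Q.coeff k) (k : ℕ) : 0 ≤ (P * Q).coeff k := by
  rw [Polynomial.coeff_mul]
  exact Finset.sum_nonneg fun i _ => mul_nonneg (hP _) (hQ _)

lemma sqrtPoly_coeff_nonneg (n k : ℕ) : 0 ≤ (sqrtPoly n).coeff k := by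
  induction n generalizing k with
  | zero => simp [sqrtPoly]
  | succ n ih =>
    rw [sqrtPoly, Polynomial.coeff_C_mul, Polynomial.coeff_add, sq]
    have h1 : 0 ≤ (Polynomial.X : Polynomial ℝ).coeff k := by
      rw [Polynomial.coeff_X]; split_ifs <;> norm_num
    have h2 := coeff_mul_nonneg ih ih k
    positivity

lemma sqrtPoly_sub_coeff_nonneg (n k : ℕ) :
    0 ≤ (sqrtPoly (n + 1) - sqrtPoly n).coeff k := by
  induction n generalizing k with
  | zero =>
    have := sqrtPoly_coeff_nonneg 1 k
    simpa [sqrtPoly] using this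
  | succ n ih =>
    have h : sqrtPoly (n + 1 + 1) - sqrtPoly (n + 1) = Polynomial.C (1 / 2) *
        ((sqrtPoly (n + 1) - sqrtPoly n) * (sqrtPoly (n + 1) + sqrtPoly n)) := by
      conv_lhs => rw [sqrtPoly]
      conv_lhs => rw [sqrtPoly.eq_2 n]
      conv_rhs => rw [sqrtPoly.eq_2 n]
      ring
    rw [h, Polynomial.coeff_C_mul]
    refine mul_nonneg (by norm_num) (coeff_mul_nonneg ih (fun j => ?_) k)
    rw [Polynomial.coeff_add]
    exact add_nonneg (sqrtPoly_coeff_nonneg _ _) (sqrtPoly_coeff_nonneg _ _)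

lemma sqrtPoly_eval_le_one (n : ℕ) : 0 ≤ (sqrtPoly n).eval 1 ∧ (sqrtPoly n).eval 1 ≤ 1 := by
  induction n with
  | zero => simp [sqrtPoly]
  | succ n ih =>
    simp only [sqrtPoly, Polynomial.eval_mul, Polynomial.eval_C, Polynomial.eval_add,
      Polynomial.eval_X, Polynomial.eval_pow]
    constructor <;> nlinarith [ih.1, ih.2]

lemma norm_aeval_le {A : H →L[ℝ] H} (hA : ‖A‖ ≤ 1) {P : Polynomial ℝ}
    (hP : ∀ k, 0 ≤ P.coeff k) : ‖Polynomial.aeval A P‖ ≤ P.eval 1 := by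
  have hpow : ∀ k : ℕ, ‖A ^ k‖ ≤ 1 := by
    intro k
    induction k with
    | zero => simpa using! ContinuousLinearMap.norm_id_le
    | succ k ih =>
      rw [pow_succ]
      exact (norm_mul_le _ _).trans (mul_le_one₀ ih (norm_nonneg _) hA)
  rw [Polynomial.aeval_eq_sum_range, Polynomial.eval_eq_sum_range]
  refine (norm_sum_le _ _).trans (Finset.sum_le_sum fun i _ => ?_)
  rw [norm_smul, Real.norm_of_nonneg (hP i), one_pow]
  exact mul_le_mul_of_nonneg_left (hpow i) (hP i)

lemma exists_sqrt_one_sub [CompleteSpace H] {A : H →L[ℝ] H} (hA : ‖A‖ ≤ 1)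
    (hs : IsSelfAdjoint A) : ∃ S : H →L[ℝ] H, S.IsPositive ∧ S * S = 1 - A := by
  let Y : ℕ → (H →L[ℝ] H) := fun n => Polynomial.aeval A (sqrtPoly n)
  have hstep : ∀ n, ‖Y (n + 1) - Y n‖ ≤ (sqrtPoly (n + 1)).eval 1 - (sqrtPoly n).eval 1 := by
    intro n
    rw [← Polynomial.eval_sub]
    simpa only [Y, map_sub] using norm_aeval_le hA (sqrtPoly_sub_coeff_nonneg n)
  have hsum : Summable fun n => (sqrtPoly (n + 1)).eval 1 - (sqrtPoly n).eval 1 := by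
    refine summable_of_sum_range_le (c := 1)
      (fun n => (norm_nonneg _).trans (hstep n)) fun n => ?_
    rw [Finset.sum_range_sub (fun n => (sqrtPoly n).eval 1)]
    have := (sqrtPoly_eval_le_one n).2
    simpa [sqrtPoly] using this
  have hcau : CauchySeq Y := by
    refine cauchySeq_of_dist_le_of_summable _ (fun n => ?_) hsum
    rw [dist_comm, dist_eq_norm]
    exact hstep n
  obtain ⟨Z, hZ⟩ := cauchySeq_tendsto_of_complete hcau
  have hrec : ∀ n, Y (n + 1) = (1 / 2 : ℝ) • (A + Y n * Y n) := by
    intro n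
    simp only [Y, sqrtPoly, map_mul, map_add, Polynomial.aeval_C, Polynomial.aeval_X,
      Algebra.algebraMap_eq_smul_one, smul_mul_assoc, one_mul, sq]
  have hfix : Z = (1 / 2 : ℝ) • (A + Z * Z) := by
    refine tendsto_nhds_unique ((Filter.tendsto_add_atTop_iff_nat 1).2 hZ) ?_
    simp only [hrec]
    exact (tendsto_const_nhds.add (hZ.mul hZ)).const_smul _
  have hYs : ∀ n, IsSelfAdjoint (Y n) := by
    intro n
    induction n with
    | zero => simp [Y, sqrtPoly]
    | succ n ih =>
      rw [hrec]
      refine IsSelfAdjoint.smul (IsSelfAdjoint.all _) (hs.add ?_)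
      rw [← sq]
      exact ih.pow 2
  have hZs : IsSelfAdjoint Z :=
    tendsto_nhds_unique (hZ.star.congr fun n => (hYs n).star_eq) hZ
  have hZn : ‖Z‖ ≤ 1 := le_of_tendsto hZ.norm
    (Filter.Eventually.of_forall fun n =>
      (norm_aeval_le hA (sqrtPoly_coeff_nonneg n)).trans (sqrtPoly_eval_le_one n).2)
  refine ⟨1 - Z, ?_, ?_⟩
  · rw [ContinuousLinearMap.isPositive_def']
    refine ⟨(IsSelfAdjoint.one _).sub hZs, fun x => ?_⟩
    simp only [ContinuousLinearMap.reApplyInnerSelf_apply, sub_apply,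
      one_apply_eq_self, inner_sub_left, real_inner_self_eq_norm_sq]
    have h1 : ⟪Z x, x⟫_ℝ ≤ ‖x‖ * ‖x‖ := (real_inner_le_norm _ _).trans
      (mul_le_mul_of_nonneg_right ((Z.le_of_opNorm_le hZn x).trans (by simp)) (norm_nonneg _))
    simp only [RCLike.re_to_real]
    nlinarith
  · have h2 : Z + Z = A + Z * Z := by
      nth_rewrite 1 2 [hfix]
      rw [← add_smul]; norm_num
    have : (1 - Z) * (1 - Z) = 1 - (Z + Z) + Z * Z := by noncomm_ring
    rw [this, h2]; abel

lemma exists_sqrt [CompleteSpace H] {R : H →L[ℝ] H} (hR : R.IsPositive) :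
    ∃ S : H →L[ℝ] H, S.IsPositive ∧ S * S = R := by
  set c : ℝ := ‖R‖ + 1 with hc
  have hc0 : 0 < c := by positivity
  have hsa : IsSelfAdjoint (1 - c⁻¹ • R) :=
    (IsSelfAdjoint.one _).sub (IsSelfAdjoint.smul (IsSelfAdjoint.all _) hR.isSelfAdjoint)
  have hn : ‖1 - c⁻¹ • R‖ ≤ 1 := by
    rw [ContinuousLinearMap.norm_eq_iSup_rayleighQuotient _
      (ContinuousLinearMap.isSelfAdjoint_iff_isSymmetric.1 hsa)]
    refine ciSup_le fun x => ?_
    have h0 : 0 ≤ ⟪R x, x⟫_ℝ := hR.inner_nonneg_left x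
    have h1 : c⁻¹ * ⟪R x, x⟫_ℝ ≤ ‖x‖ ^ 2 := by
      rw [inv_mul_le_iff₀ hc0]
      have := real_inner_le_norm (R x) x
      have := R.le_opNorm x
      nlinarith [norm_nonneg x, mul_le_mul_of_nonneg_right this (norm_nonneg x)]
    have h2 : 0 ≤ c⁻¹ * ⟪R x, x⟫_ℝ := by positivity
    rw [ContinuousLinearMap.rayleighQuotient, ContinuousLinearMap.reApplyInnerSelf_apply]
    simp only [sub_apply, one_apply_eq_self,
      smul_apply, inner_sub_left, real_inner_smul_left,
      real_inner_self_eq_norm_sq, RCLike.re_to_real]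
    rw [abs_of_nonneg (div_nonneg (by linarith) (by positivity))]
    exact div_le_one_of_le₀ (by linarith) (by positivity)
  obtain ⟨S, hS, hSS⟩ := exists_sqrt_one_sub hn hsa
  refine ⟨Real.sqrt c • S, hS.smul_of_nonneg (by simp), ?_⟩
  rw [smul_mul_smul_comm, Real.mul_self_sqrt hc0.le, hSS, sub_sub_cancel, smul_smul,
    mul_inv_cancel₀ hc0.ne', one_smul]

open Classical in
/-- `R^{1/2}`: the (unique) positive square root of a positive operator `R`. -/
def opSqrt [CompleteSpace H] (R : H →L[ℝ] H) : H →L[ℝ] H :=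
  if h : R.IsPositive then (exists_sqrt h).choose else 0

lemma opSqrt_isPositive [CompleteSpace H] {R : H →L[ℝ] H} (hR : R.IsPositive) :
    (opSqrt R).IsPositive := by
  rw [opSqrt, dif_pos hR]; exact (exists_sqrt hR).choose_spec.1

lemma opSqrt_mul_self [CompleteSpace H] {R : H →L[ℝ] H} (hR : R.IsPositive) :
    opSqrt R * opSqrt R = R := by
  rw [opSqrt, dif_pos hR]; exact (exists_sqrt hR).choose_spec.2

lemma exists_pseudoInv [CompleteSpace H] (S : H →L[ℝ] H) (h : H) (hh : h ∈ Set.range S) :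
    ∃ g : H, g ∈ (LinearMap.ker (S : H →ₗ[ℝ] H))ᗮ ∧ S g = h := by
  obtain ⟨u, rfl⟩ := hh
  have hclosed : IsClosed (LinearMap.ker (S : H →ₗ[ℝ] H) : Set H) := S.isClosed_ker
  have : CompleteSpace (LinearMap.ker (S : H →ₗ[ℝ] H)) := hclosed.completeSpace_coe
  obtain ⟨y, hy, z, hz, rfl⟩ :=
    (LinearMap.ker (S : H →ₗ[ℝ] H)).exists_add_mem_mem_orthogonal u
  refine ⟨z, hz, ?_⟩
  have : S y = 0 := hy
  simp [this]

open Classical in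
/-- `S^{-1}`: the pseudo-inverse of a bounded operator, defined on the range of `S`. It sends `h`
to the unique `g` orthogonal to `ker S` with `S g = h`; outside the range it has the value `0`. -/
def pseudoInv [CompleteSpace H] (S : H →L[ℝ] H) (h : H) : H :=
  if hh : h ∈ Set.range S then (exists_pseudoInv S h hh).choose else 0

lemma pseudoInv_mem [CompleteSpace H] {S : H →L[ℝ] H} {h : H} (hh : h ∈ Set.range S) :
    pseudoInv S h ∈ (LinearMap.ker (S : H →ₗ[ℝ] H))ᗮ := by
  rw [pseudoInv, dif_pos hh]; exact (exists_pseudoInv S h hh).choose_spec.1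

lemma apply_pseudoInv [CompleteSpace H] {S : H →L[ℝ] H} {h : H} (hh : h ∈ Set.range S) :
    S (pseudoInv S h) = h := by
  rw [pseudoInv, dif_pos hh]; exact (exists_pseudoInv S h hh).choose_spec.2

/-- `R^{-1/2} U` with domain `gammaDomain R U = {x | U x ∈ R^{1/2}(H)}`. -/
def gamma [CompleteSpace H] (R U : H →L[ℝ] H) (x : H) : H :=
  pseudoInv (opSqrt R) (U x)

def gammaDomain [CompleteSpace H] (R U : H →L[ℝ] H) : Set H :=
  {x | U x ∈ Set.range (opSqrt R)}

open Classical in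
/-- `|R^{-1/2} U x|`, with the value `∞` outside the domain. -/
def gammaNorm [CompleteSpace H] (R U : H →L[ℝ] H) (x : H) : ℝ≥0∞ :=
  if x ∈ gammaDomain R U then ENNReal.ofReal ‖gamma R U x‖ else ⊤

/-- Evolution families `U(t,s)`, `t ≥ s`; the values `U t s` with `t < s` are irrelevant. -/
structure IsEvolutionFamily (U : ℝ → ℝ → H →L[ℝ] H) : Prop where
  refl : ∀ s, U s s = ContinuousLinearMap.id ℝ H
  comp : ∀ s r t, s ≤ r → r ≤ t → (U t r).comp (U r s) = U t s
  continuousOn : ∀ x, ContinuousOn (fun p : ℝ × ℝ => U p.1 p.2 x) {p | p.2 ≤ p.1}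

end Operators

section Measures

variable {H : Type*} [NormedAddCommGroup H] [InnerProductSpace ℝ H] [MeasurableSpace H]

structure IsLevyMeasure (m : Measure H) : Prop where
  zero : m {0} = 0
  lintegral_lt_top : ∫⁻ x, ENNReal.ofReal (min 1 (‖x‖ ^ 2)) ∂m < ⊤

/-- The Lévy–Khintchine exponent `ψ` of the triplet `[a, R, m]`. -/
def levyExponent (a : H) (R : H →L[ℝ] H) (m : Measure H) (ξ : H) : ℂ :=
  -Complex.I * (⟪a, ξ⟫_ℝ : ℂ) + (1 / 2 : ℂ) * (⟪ξ, R ξ⟫_ℝ : ℂ)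
    - ∫ x, (Complex.exp (Complex.I * (⟪ξ, x⟫_ℝ : ℂ)) - 1
        - Complex.I * (⟪ξ, x⟫_ℝ : ℂ) / ((1 + ‖x‖ ^ 2 : ℝ) : ℂ)) ∂m

/-- `μ = D[a, R, m]`: the infinitely divisible law with characteristic triplet `[a, R, m]`. -/
structure IsLevyKhintchine [CompleteSpace H] (μ : Measure H) (a : H) (R : H →L[ℝ] H)
    (m : Measure H) : Prop where
  isProbabilityMeasure : IsProbabilityMeasure μ
  traceClass : IsPositiveTraceClass R
  levyMeasure : IsLevyMeasure m
  charFun_eq : ∀ ξ, charFun μ ξ = Complex.exp (-levyExponent a R m ξ)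

/-- `μ_{t,s} = μ_{t,r} * (μ_{r,s} ∘ U(t,r)⁻¹)` for `s ≤ r ≤ t`. -/
def IsSkewConvolution (U : ℝ → ℝ → H →L[ℝ] H) (μ : ℝ → ℝ → Measure H) : Prop :=
  ∀ s r t, s ≤ r → r ≤ t → μ t s = (μ t r).conv ((μ r s).map (U t r))

/-- The Mehler operators `p_{s,t} f (x) = ∫ f (U(t,s) x + y) μ_{t,s}(dy)`. -/
def mehlerOp (U : ℝ → ℝ → H →L[ℝ] H) (μ : ℝ → ℝ → Measure H) (s t : ℝ) (f : H → ℝ) (x : H) : ℝ :=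
  ∫ y, f (U t s x + y) ∂(μ t s)

end Measures

/-- `exp (α c² / (2 (α - 1))) * q`, understood as `∞` if `c = ∞` (also when `q = 0`). -/
def harnackBound (α : ℝ) (c : ℝ≥0∞) (q : ℝ) : EReal :=
  if c = ⊤ then ⊤ else ((Real.exp (α * c.toReal ^ 2 / (2 * (α - 1))) * q : ℝ) : EReal)

end Mehler

end

open ProbabilityTheory Filter Topology
open scoped NNReal BoundedContinuousFunction Nat

namespace Mehler

/-! With `h = U(t,s)(x - y)`, the value at `x` is an integral of a shift by `h` of the function
integrated at `y`, so everything reduces to a shift inequality for the single measure `μ_{t,s}`. If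
`h = R^{1/2} g`, write `h = |g| v` with `v ⊗ v ≤ R` (`exists_inner_sq_le`). Formally, the law is
then the convolution of a one-dimensional Gaussian along `v`, a Gaussian of covariance `R - v ⊗ v`,
and a drift-and-jump law. The shift acts on the first factor only, where the density of a translated
Gaussian and Hölder's inequality give exactly the stated constant (`shiftBound_gaussianReal`);
convolving with any probability measure keeps the constant, by Jensen (`ShiftBound.conv`).

The factorization is carried out only for finite-dimensional images and with small jumps removed,
where each factor is explicit. Convergence of characteristic functions removes the truncation
(`IsLevyKhintchine.shiftBoundCts_map`), and projections increasing to the identity remove the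
restriction on dimension (`shiftBoundCts_of_forall_finiteDimensional`). Both limits are taken on
bounded continuous test functions; density in `L^α` then reaches bounded measurable ones
(`ShiftBoundCts.eLpNorm_le_of_memLp`). -/

/-- The translate of `μ` by `h` satisfies a dimension-free Harnack inequality of power `α` with
constant `K` with respect to `μ`. -/
def ShiftBound {E : Type*} [Add E] [MeasurableSpace E] (α : ℝ) (K : ℝ≥0∞) (h : E)
    (μ : Measure E) : Prop :=
  ∀ F : E → ℝ≥0∞, Measurable F → (∫⁻ z, F (z + h) ∂μ) ^ α ≤ K * ∫⁻ z, F z ^ α ∂μ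

/-- The constant in the Harnack inequality for a shift of Cameron–Martin norm `c`. -/
noncomputable def harnackConst (α c : ℝ) : ℝ :=
  Real.exp (α * c ^ 2 / (2 * (α - 1)))

/-! ### The shift inequality for the standard Gaussian on the line. -/

lemma lintegral_gaussianReal_shift (c : ℝ) {F : ℝ → ℝ≥0∞} (hF : Measurable F) :
    ∫⁻ z, F (z + c) ∂(gaussianReal 0 1) =
      ∫⁻ z, F z * ENNReal.ofReal (Real.exp (c * z - c ^ 2 / 2)) ∂(gaussianReal 0 1) := by
  have h1 : ∫⁻ z, F (z + c) ∂(gaussianReal 0 1) = ∫⁻ z, F z ∂(gaussianReal c 1) := by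
    have := gaussianReal_map_add_const (μ := 0) (v := 1) c
    rw [zero_add] at this
    rw [← this, lintegral_map hF (by fun_prop)]
  rw [h1, gaussianReal_of_var_ne_zero _ one_ne_zero, gaussianReal_of_var_ne_zero _ one_ne_zero,
    lintegral_withDensity_eq_lintegral_mul _ (measurable_gaussianPDF _ _) hF,
    lintegral_withDensity_eq_lintegral_mul _ (measurable_gaussianPDF _ _) (by fun_prop)]
  refine lintegral_congr fun z => ?_
  simp only [Pi.mul_apply, gaussianPDF, gaussianPDFReal, NNReal.coe_one, mul_one, sub_zero]
  rw [mul_comm (F z), ← mul_assoc, ← ENNReal.ofReal_mul (by positivity), mul_assoc _ (Real.exp _),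
    ← Real.exp_add]
  congr 4
  ring

lemma lintegral_exp_gaussianReal (b d : ℝ) :
    ∫⁻ z, ENNReal.ofReal (Real.exp (b * z - d)) ∂(gaussianReal 0 1) =
      ENNReal.ofReal (Real.exp (b ^ 2 / 2 - d)) := by
  have hint : Integrable (fun z => Real.exp (b * z)) (gaussianReal 0 1) :=
    integrable_exp_mul_gaussianReal b
  have hm := congrFun (mgf_fun_id_gaussianReal (μ := 0) (v := 1)) b
  simp only [mgf, zero_mul, NNReal.coe_one, one_mul, zero_add] at hm
  simp_rw [sub_eq_add_neg, Real.exp_add]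
  rw [← ofReal_integral_eq_lintegral_ofReal (hint.mul_const _)
    (Eventually.of_forall fun z => by positivity), integral_mul_const, hm]

/-- Hölder with exponents `α` and `β = α / (α - 1)`: the `β`-th moment of the Cameron–Martin density
is `exp ((β² - β) c² / 2)`, and its power `α / β` is the constant, since `β - 1 = 1 / (α - 1)`. -/
lemma shiftBound_gaussianReal {α : ℝ} (hα : 1 < α) (c : ℝ) :
    ShiftBound α (ENNReal.ofReal (harnackConst α c)) c (gaussianReal 0 1) := by
  intro F hF
  have hpq := Real.HolderConjugate.conjExponent hα
  set β := α.conjExponent with hβ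
  have hα0 : 0 < α := by linarith
  have hα1 : α - 1 ≠ 0 := by linarith
  have hβ0 : 0 < β := hpq.symm.pos
  rw [lintegral_gaussianReal_shift c hF]
  have hH := ENNReal.lintegral_mul_le_Lp_mul_Lq (gaussianReal 0 1) hpq hF.aemeasurable
    (g := fun z => ENNReal.ofReal (Real.exp (c * z - c ^ 2 / 2))) (by fun_prop)
  have hg : ∫⁻ z, ENNReal.ofReal (Real.exp (c * z - c ^ 2 / 2)) ^ β ∂(gaussianReal 0 1) =
      ENNReal.ofReal (Real.exp ((β * c) ^ 2 / 2 - β * (c ^ 2 / 2))) := by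
    rw [← lintegral_exp_gaussianReal]
    refine lintegral_congr fun z => ?_
    rw [ENNReal.ofReal_rpow_of_pos (Real.exp_pos _), ← Real.exp_mul]
    congr 2; ring
  rw [hg] at hH
  refine (ENNReal.rpow_le_rpow hH hα0.le).trans (le_of_eq ?_)
  rw [ENNReal.mul_rpow_of_nonneg _ _ hα0.le, ← ENNReal.rpow_mul, ← ENNReal.rpow_mul,
    one_div_mul_cancel hα0.ne', ENNReal.rpow_one, mul_comm,
    ENNReal.ofReal_rpow_of_pos (Real.exp_pos _), ← Real.exp_mul, harnackConst]
  congr 3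
  rw [hβ, Real.conjExponent]
  field_simp
  ring

/-! ### Stability under linear images and convolution. -/

section Stability

variable {E : Type*} [AddCommGroup E] [MeasurableSpace E] {α : ℝ} {K : ℝ≥0∞} {h : E}

lemma ShiftBound.map {E' : Type*} [AddCommGroup E'] [MeasurableSpace E'] [MeasurableAdd₂ E']
    {μ : Measure E} (hμ : ShiftBound α K h μ) (L : E →+ E') (hL : Measurable L) :
    ShiftBound α K (L h) (μ.map L) := by
  intro F hF
  rw [lintegral_map (by fun_prop) hL, lintegral_map (by fun_prop) hL]
  simpa only [map_add] using! hμ (fun z => F (L z)) (by fun_prop)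

lemma rpow_lintegral_le {X : Type*} [MeasurableSpace X] (ν : Measure X) [IsProbabilityMeasure ν]
    (hα : 1 < α) {F : X → ℝ≥0∞} (hF : AEMeasurable F ν) :
    (∫⁻ x, F x ∂ν) ^ α ≤ ∫⁻ x, F x ^ α ∂ν := by
  have hα0 : 0 < α := by linarith
  have hH := ENNReal.lintegral_mul_le_Lp_mul_Lq ν (Real.HolderConjugate.conjExponent hα) hF
    (g := fun _ => 1) (by fun_prop)
  simp only [Pi.mul_apply, mul_one, ENNReal.one_rpow, lintegral_const, measure_univ] at hH
  refine (ENNReal.rpow_le_rpow hH hα0.le).trans (le_of_eq ?_)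
  rw [← ENNReal.rpow_mul, one_div_mul_cancel hα0.ne', ENNReal.rpow_one]

/-- The inequality for `μ` holds for each fixed value of the `ν`-variable; Jensen moves the power
`α` inside the `ν`-integral at no cost. -/
lemma ShiftBound.conv [MeasurableAdd₂ E] {μ ν : Measure E} [SFinite μ] [IsProbabilityMeasure ν]
    (hα : 1 < α) (hμ : ShiftBound α K h μ) : ShiftBound α K h (ν.conv μ) := by
  intro F hF
  rw [Measure.lintegral_conv (by fun_prop), Measure.lintegral_conv (by fun_prop)]
  refine (rpow_lintegral_le ν hα (Measurable.lintegral_prod_right (by fun_prop)).aemeasurable).trans ?_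
  rw [← lintegral_const_mul _ (Measurable.lintegral_prod_right (by fun_prop))]
  refine lintegral_mono fun w => ?_
  simpa only [add_assoc] using! hμ (fun z => F (w + z)) (by fun_prop)

end Stability

/-! ### Bounded continuous test functions and weak limits. -/

/-- The Harnack inequality of `ShiftBound`, for bounded continuous functions only. -/
def ShiftBoundCts {E : Type*} [Add E] [TopologicalSpace E] [MeasurableSpace E] (α : ℝ) (K : ℝ≥0∞)
    (h : E) (μ : Measure E) : Prop :=
  ∀ F : E →ᵇ ℝ≥0, (∫⁻ z, (F (z + h) : ℝ≥0∞) ∂μ) ^ α ≤ K * ∫⁻ z, (F z : ℝ≥0∞) ^ α ∂μ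

lemma ShiftBound.shiftBoundCts {E : Type*} [Add E] [TopologicalSpace E] [MeasurableSpace E]
    [OpensMeasurableSpace E] {α : ℝ} {K : ℝ≥0∞} {h : E} {μ : Measure E}
    (hμ : ShiftBound α K h μ) : ShiftBoundCts α K h μ := fun F =>
  hμ (fun z => F z) (measurable_coe_nnreal_ennreal.comp F.continuous.measurable)

/-- The pointwise power of a bounded continuous function. -/
noncomputable def bcfRpow {E : Type*} [TopologicalSpace E] (F : E →ᵇ ℝ≥0) {α : ℝ} (hα : 0 ≤ α) :
    E →ᵇ ℝ≥0 :=
  BoundedContinuousFunction.mkOfBound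
    ⟨fun z => F z ^ α, (NNReal.continuous_rpow_const hα).comp F.continuous⟩ (nndist F 0 ^ α)
    fun x y => by
      have hb : ∀ z, F z ^ α ≤ nndist F 0 ^ α := fun z =>
        NNReal.rpow_le_rpow (BoundedContinuousFunction.NNReal.upper_bound F z) hα
      have hx : ((F x ^ α : ℝ≥0) : ℝ) ≤ _ := NNReal.coe_le_coe.2 (hb x)
      have hy : ((F y ^ α : ℝ≥0) : ℝ) ≤ _ := NNReal.coe_le_coe.2 (hb y)
      have h0x : 0 ≤ ((F x ^ α : ℝ≥0) : ℝ) := NNReal.coe_nonneg _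
      have h0y : 0 ≤ ((F y ^ α : ℝ≥0) : ℝ) := NNReal.coe_nonneg _
      simp only [ContinuousMap.coe_mk, NNReal.dist_eq, NNReal.coe_rpow] at *
      rw [abs_le]
      constructor <;> linarith

@[simp]
lemma bcfRpow_apply {E : Type*} [TopologicalSpace E] (F : E →ᵇ ℝ≥0) {α : ℝ} (hα : 0 ≤ α) (z : E) :
    bcfRpow F hα z = F z ^ α := rfl

section WeakLimit

variable {E : Type*} [AddCommGroup E] [TopologicalSpace E] [IsTopologicalAddGroup E]
  [MeasurableSpace E] [BorelSpace E] {α : ℝ} {K : ℝ≥0∞} {h : E}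

/-- For a bounded continuous test function, both its translate and its power `α` are again bounded
continuous, so each side converges. Finiteness of `K` makes multiplication by it continuous. -/
lemma shiftBoundCts_of_tendsto {μs : ℕ → ProbabilityMeasure E} {μ : ProbabilityMeasure E}
    (hα : 0 ≤ α) (hK : K ≠ ⊤) (hlim : Tendsto μs atTop (𝓝 μ))
    (hμ : ∀ n, ShiftBound α K h (μs n : Measure E)) : ShiftBoundCts α K h (μ : Measure E) := by
  intro F
  rw [ProbabilityMeasure.tendsto_iff_forall_lintegral_tendsto] at hlim
  have h1 := hlim (F.compContinuous ⟨fun z => z + h, by fun_prop⟩)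
  have h2 := hlim (bcfRpow F hα)
  simp only [BoundedContinuousFunction.compContinuous_apply, ContinuousMap.coe_mk,
    bcfRpow_apply, ENNReal.coe_rpow_of_nonneg _ hα] at h1 h2
  refine le_of_tendsto_of_tendsto' ((ENNReal.continuous_rpow_const.tendsto _).comp h1)
    (ENNReal.Tendsto.const_mul h2 (Or.inr hK)) fun n => ?_
  have := (hμ n).shiftBoundCts F
  exact this

end WeakLimit

/-! ### Compound Poisson laws of finite jump measures. -/

section CompoundPoisson

variable {H : Type*} [NormedAddCommGroup H] [InnerProductSpace ℝ H] [MeasurableSpace H]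
  [BorelSpace H] [SecondCountableTopology H]

/-- Iterated convolution. -/
noncomputable def convPow (m : Measure H) : ℕ → Measure H
  | 0 => Measure.dirac 0
  | n + 1 => (convPow m n).conv m

instance isFiniteMeasure_convPow (m : Measure H) [IsFiniteMeasure m] (n : ℕ) :
    IsFiniteMeasure (convPow m n) := by
  induction n with
  | zero => rw [convPow]; infer_instance
  | succ n ih => rw [convPow]; infer_instance

lemma charFun_convPow (m : Measure H) [IsFiniteMeasure m] (n : ℕ) (ξ : H) :
    charFun (convPow m n) ξ = charFun m ξ ^ n := by
  induction n with
  | zero => simp [convPow, charFun_dirac]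
  | succ n ih => rw [convPow, charFun_conv, ih, pow_succ]

/-- The total mass is the characteristic function at `0`. -/
lemma convPow_univ (m : Measure H) [IsFiniteMeasure m] (n : ℕ) :
    convPow m n Set.univ = ENNReal.ofReal (m.real Set.univ ^ n) := by
  have h := charFun_convPow m n 0
  rw [charFun_zero, charFun_zero, ← Complex.ofReal_pow, Complex.ofReal_inj] at h
  rw [← h, ofReal_measureReal]

/-- The compound Poisson law with jump measure `m`. -/
noncomputable def compoundPoisson (m : Measure H) : Measure H :=
  Measure.sum fun n : ℕ =>
    ENNReal.ofReal (Real.exp (-m.real Set.univ) / n !) • convPow m n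

instance isProbabilityMeasure_compoundPoisson (m : Measure H) [IsFiniteMeasure m] :
    IsProbabilityMeasure (compoundPoisson m) := by
  constructor
  set c := m.real Set.univ
  have hs : HasSum (fun n : ℕ => Real.exp (-c) * (c ^ n / n !)) 1 := by
    have := (NormedSpace.expSeries_div_hasSum_exp c).mul_left (Real.exp (-c))
    rwa [← Real.exp_eq_exp_ℝ, ← Real.exp_add, neg_add_cancel, Real.exp_zero] at this
  have hc : 0 ≤ c := measureReal_nonneg
  rw [compoundPoisson, Measure.sum_apply _ MeasurableSet.univ]
  simp only [Measure.smul_apply, smul_eq_mul, convPow_univ]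
  rw [← ENNReal.ofReal_one, ← hs.tsum_eq, ENNReal.ofReal_tsum_of_nonneg
    (fun n => by positivity) hs.summable]
  refine tsum_congr fun n => ?_
  rw [← ENNReal.ofReal_mul (by positivity)]
  congr 1
  ring

lemma charFun_compoundPoisson (m : Measure H) [IsFiniteMeasure m] (ξ : H) :
    charFun (compoundPoisson m) ξ = Complex.exp (charFun m ξ - (m.real Set.univ : ℂ)) := by
  have hint : Integrable (fun x => Complex.exp (⟪x, ξ⟫_ℝ * Complex.I)) (compoundPoisson m) := by
    refine (integrable_const (1 : ℝ)).mono' (by fun_prop) (Eventually.of_forall fun x => ?_)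
    rw [Complex.norm_exp_ofReal_mul_I]
  have h := hasSum_integral_measure (μ := fun n : ℕ =>
    ENNReal.ofReal (Real.exp (-m.real Set.univ) / n !) • convPow m n) hint
  have h2 : HasSum (fun n : ℕ => Complex.exp (-(m.real Set.univ : ℂ)) * (charFun m ξ ^ n / n !))
      (Complex.exp (-(m.real Set.univ : ℂ)) * Complex.exp (charFun m ξ)) := by
    rw [Complex.exp_eq_exp_ℂ]
    exact (NormedSpace.expSeries_div_hasSum_exp (charFun m ξ)).mul_left _
  rw [sub_eq_neg_add, Complex.exp_add]
  refine h.unique (h2.congr_fun fun n => ?_) |>.trans rfl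
  rw [integral_smul_measure, ← charFun_apply, charFun_convPow, ENNReal.toReal_ofReal (by positivity),
    Complex.real_smul]
  push_cast
  ring

end CompoundPoisson

/-! ### Lévy measures with the small jumps cut off. -/

section LevyTruncation

variable {H : Type*} [NormedAddCommGroup H] [InnerProductSpace ℝ H]

lemma norm_exp_I_mul_sub_one_sub_le (θ : ℝ) :
    ‖Complex.exp (Complex.I * θ) - 1 - Complex.I * θ‖ ≤ 2 * θ ^ 2 := by
  have hI : ‖Complex.I * (θ : ℂ)‖ = |θ| := by simp
  rcases le_total |θ| 1 with h | h
  · have := Complex.norm_exp_sub_one_sub_id_le (x := Complex.I * θ) (by rwa [hI])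
    rw [hI, sq_abs] at this
    nlinarith [sq_nonneg θ]
  · have h1 := Real.norm_exp_I_mul_ofReal_sub_one_le (x := θ)
    rw [Real.norm_eq_abs] at h1
    refine (norm_sub_le _ _).trans ?_
    rw [hI, ← sq_abs]
    nlinarith

/-- The integrand of the jump part of the Lévy–Khintchine exponent. -/
noncomputable def levyIntegrand (ξ x : H) : ℂ :=
  Complex.exp (Complex.I * (⟪ξ, x⟫_ℝ : ℂ)) - 1
    - Complex.I * (⟪ξ, x⟫_ℝ : ℂ) / ((1 + ‖x‖ ^ 2 : ℝ) : ℂ)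

/-- For `‖x‖ ≤ 1`, replacing the compensator by `iθ` costs `θ ‖x‖² / (1 + ‖x‖²)` and leaves a
second-order Taylor remainder; for `‖x‖ ≥ 1` the exponential part and the compensator are bounded
separately. The constant is large enough for both cases. -/
lemma norm_levyIntegrand_le (ξ x : H) :
    ‖levyIntegrand ξ x‖ ≤ (2 * ‖ξ‖ ^ 2 + ‖ξ‖ + 2) * min 1 (‖x‖ ^ 2) := by
  have hin := abs_real_inner_le_norm ξ x
  have hξ := norm_nonneg ξ
  have hx := norm_nonneg x
  rw [levyIntegrand]
  set θ : ℝ := ⟪ξ, x⟫_ℝ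
  have hpos : 0 < 1 + ‖x‖ ^ 2 := by positivity
  rcases le_total ‖x‖ 1 with h | h
  · have hsq : ‖x‖ ^ 2 ≤ 1 := by nlinarith
    rw [min_eq_right hsq]
    have hdec : Complex.exp (Complex.I * (θ : ℂ)) - 1
        - Complex.I * (θ : ℂ) / ((1 + ‖x‖ ^ 2 : ℝ) : ℂ) =
        (Complex.exp (Complex.I * θ) - 1 - Complex.I * θ) +
          Complex.I * ((θ * (‖x‖ ^ 2 / (1 + ‖x‖ ^ 2)) : ℝ) : ℂ) := by
      have : ((1 + ‖x‖ ^ 2 : ℝ) : ℂ) ≠ 0 := by exact_mod_cast hpos.ne'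
      push_cast at this ⊢
      field_simp
      ring
    rw [hdec]
    refine (norm_add_le _ _).trans ?_
    have h1 := norm_exp_I_mul_sub_one_sub_le θ
    have h2 : θ ^ 2 ≤ ‖ξ‖ ^ 2 * ‖x‖ ^ 2 := by
      rw [← sq_abs, ← mul_pow]; gcongr
    have h3 : ‖Complex.I * ((θ * (‖x‖ ^ 2 / (1 + ‖x‖ ^ 2)) : ℝ) : ℂ)‖ ≤ ‖ξ‖ * ‖x‖ ^ 2 := by
      rw [norm_mul, Complex.norm_I, one_mul, Complex.norm_real, norm_mul, Real.norm_eq_abs,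
        Real.norm_of_nonneg (by positivity)]
      have h4 : ‖x‖ ^ 2 / (1 + ‖x‖ ^ 2) ≤ ‖x‖ ^ 2 := div_le_self (by positivity) (by nlinarith)
      have h5 : |θ| ≤ ‖ξ‖ := hin.trans (mul_le_of_le_one_right hξ h)
      gcongr
    nlinarith [sq_nonneg ‖x‖]
  · have hsq : 1 ≤ ‖x‖ ^ 2 := by nlinarith
    rw [min_eq_left hsq, mul_one]
    refine (norm_sub_le _ _).trans ?_
    have h1 : ‖Complex.exp (Complex.I * (θ : ℂ)) - 1‖ ≤ 2 := by
      refine (norm_sub_le _ _).trans ?_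
      rw [Complex.norm_exp_I_mul_ofReal, norm_one]; norm_num
    have h2 : ‖Complex.I * (θ : ℂ) / ((1 + ‖x‖ ^ 2 : ℝ) : ℂ)‖ ≤ ‖ξ‖ := by
      rw [norm_div, norm_mul, Complex.norm_I, one_mul, Complex.norm_real, Complex.norm_real,
        Real.norm_eq_abs, Real.norm_of_nonneg hpos.le, div_le_iff₀ hpos]
      refine hin.trans (mul_le_mul_of_nonneg_left ?_ hξ)
      nlinarith
    nlinarith [sq_nonneg ‖ξ‖]

variable [MeasurableSpace H] [BorelSpace H] [SecondCountableTopology H] {m : Measure H}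

lemma measurable_levyIntegrand (ξ : H) : Measurable (levyIntegrand ξ) := by
  unfold levyIntegrand
  fun_prop

lemma IsLevyMeasure.integrable_min {H : Type*} [NormedAddCommGroup H] [MeasurableSpace H]
    [BorelSpace H] {m : Measure H} (hm : IsLevyMeasure m) :
    Integrable (fun x => min 1 (‖x‖ ^ 2)) m := by
  refine ⟨by fun_prop, ?_⟩
  rw [hasFiniteIntegral_iff_ofReal (Eventually.of_forall fun x => by positivity)]
  exact hm.lintegral_lt_top

lemma IsLevyMeasure.integrable_levyIntegrand (hm : IsLevyMeasure m) (ξ : H) :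
    Integrable (levyIntegrand ξ) m :=
  (hm.integrable_min.const_mul _).mono' (measurable_levyIntegrand ξ).aestronglyMeasurable
    (Eventually.of_forall fun x => norm_levyIntegrand_le ξ x)

/-- The complement of the closed ball of radius `1 / (k + 1)`. -/
def outerSet (H : Type*) [NormedAddCommGroup H] (k : ℕ) : Set H :=
  {x | 1 / ((k : ℝ) + 1) < ‖x‖}

lemma measurableSet_outerSet {H : Type*} [NormedAddCommGroup H] [MeasurableSpace H] [BorelSpace H]
    (k : ℕ) : MeasurableSet (outerSet H k) :=
  measurableSet_lt measurable_const measurable_norm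

/-- Markov's inequality for `min 1 ‖x‖²`, which is at least `min 1 ε²` on this set. -/
lemma IsLevyMeasure.isFiniteMeasure_restrict {H : Type*} [NormedAddCommGroup H] [MeasurableSpace H]
    [BorelSpace H] {m : Measure H} (hm : IsLevyMeasure m) (k : ℕ) :
    IsFiniteMeasure (m.restrict (outerSet H k)) := by
  rw [MeasureTheory.isFiniteMeasure_restrict]
  set ε : ℝ := 1 / ((k : ℝ) + 1)
  have hε : 0 < ε := by positivity
  have hpos : 0 < min 1 (ε ^ 2) := by positivity
  refine ((measure_mono fun x hx => ?_).trans_lt (hm.integrable_min.measure_ge_lt_top hpos)).ne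
  have hx' : ε < ‖x‖ := hx
  have : ε ^ 2 ≤ ‖x‖ ^ 2 := by gcongr
  exact min_le_min_left 1 this

lemma IsLevyMeasure.tendsto_setIntegral_levyIntegrand (hm : IsLevyMeasure m) (ξ : H) :
    Tendsto (fun k : ℕ => ∫ x in outerSet H k, levyIntegrand ξ x ∂m) atTop
      (𝓝 (∫ x, levyIntegrand ξ x ∂m)) := by
  have hmono : Monotone (outerSet H) := fun j k hjk x hx =>
    (Nat.one_div_le_one_div hjk).trans_lt (show 1 / ((j : ℝ) + 1) < ‖x‖ from hx)
  have h := tendsto_setIntegral_of_monotone (μ := m) (f := levyIntegrand ξ)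
    measurableSet_outerSet hmono (hm.integrable_levyIntegrand ξ).integrableOn
  have hU : (⋃ k, outerSet H k) = {0}ᶜ := by
    ext x
    simp only [Set.mem_iUnion, outerSet, Set.mem_ofPred_eq, Set.mem_compl_iff, Set.mem_singleton_iff]
    refine ⟨?_, fun hx => exists_nat_one_div_lt (norm_pos_iff.2 hx)⟩
    rintro ⟨k, hk⟩ rfl
    rw [norm_zero] at hk
    exact absurd hk (by positivity : (0 : ℝ) ≤ 1 / ((k : ℝ) + 1)).not_gt
  rwa [hU, setIntegral_eq_integral_of_ae_compl_eq_zero] at h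
  -- The sets exhaust only the complement of `0`, but the integrand vanishes at `0`.
  refine Eventually.of_forall fun x hx => ?_
  rw [Set.mem_compl_iff, not_not] at hx
  simp [levyIntegrand, Set.mem_singleton_iff.1 hx]

/-- The infinitely divisible law with drift `a` and jumps of size larger than `1 / (k + 1)`. -/
noncomputable def truncatedLevy (a : H) (m : Measure H) (k : ℕ) : Measure H :=
  (Measure.dirac (a - ∫ x in outerSet H k, (1 + ‖x‖ ^ 2)⁻¹ • x ∂m)).conv
    (compoundPoisson (m.restrict (outerSet H k)))

lemma IsLevyMeasure.isProbabilityMeasure_truncatedLevy (hm : IsLevyMeasure m) (a : H) (k : ℕ) :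
    IsProbabilityMeasure (truncatedLevy a m k) := by
  have := hm.isFiniteMeasure_restrict k
  rw [truncatedLevy]
  infer_instance

lemma IsLevyMeasure.charFun_truncatedLevy [CompleteSpace H] (hm : IsLevyMeasure m) (a : H) (k : ℕ) (ξ : H) :
    charFun (truncatedLevy a m k) ξ = Complex.exp
      (Complex.I * (⟪a, ξ⟫_ℝ : ℂ) + ∫ x in outerSet H k, levyIntegrand ξ x ∂m) := by
  have := hm.isFiniteMeasure_restrict k
  have hd : Integrable (fun x : H => (1 + ‖x‖ ^ 2)⁻¹ • x) (m.restrict (outerSet H k)) := by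
    refine (integrable_const (1 : ℝ)).mono' (by fun_prop) (Eventually.of_forall fun x => ?_)
    have hpos : 0 < 1 + ‖x‖ ^ 2 := by positivity
    rw [norm_smul, Real.norm_of_nonneg (by positivity), inv_mul_le_iff₀ hpos]
    nlinarith [sq_nonneg (‖x‖ - 1)]
  have he : Integrable (fun x : H => Complex.exp (⟪x, ξ⟫_ℝ * Complex.I))
      (m.restrict (outerSet H k)) := by
    refine (integrable_const (1 : ℝ)).mono' (by fun_prop) (Eventually.of_forall fun x => ?_)
    rw [Complex.norm_exp_ofReal_mul_I]
  have hdi : Integrable (fun x : H => ⟪ξ, (1 + ‖x‖ ^ 2)⁻¹ • x⟫_ℝ)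
      (m.restrict (outerSet H k)) := hd.const_inner ξ
  have hdc : Integrable (fun x : H => Complex.I * (⟪ξ, (1 + ‖x‖ ^ 2)⁻¹ • x⟫_ℝ : ℂ))
      (m.restrict (outerSet H k)) := hdi.ofReal.const_mul _
  -- Away from `0` the jump measure is finite, so the compensator can be integrated by itself; it is
  -- the drift correction built into `truncatedLevy`.
  have hsplit : ∫ x in outerSet H k, levyIntegrand ξ x ∂m =
      charFun (m.restrict (outerSet H k)) ξ - ((m.restrict (outerSet H k)).real Set.univ : ℂ) -
        Complex.I * (⟪∫ x in outerSet H k, (1 + ‖x‖ ^ 2)⁻¹ • x ∂m, ξ⟫_ℝ : ℂ) := by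
    rw [real_inner_comm, ← integral_inner hd, charFun_apply, ← integral_complex_ofReal,
      ← integral_const_mul]
    have h1 : ((m.restrict (outerSet H k)).real Set.univ : ℂ) =
        ∫ x in outerSet H k, (1 : ℂ) ∂m := by simp
    rw [h1, ← integral_sub he (integrable_const _),
      ← integral_sub (f := fun x : H => Complex.exp (⟪x, ξ⟫_ℝ * Complex.I) - 1)
        (he.sub (integrable_const _)) hdc]
    refine integral_congr_ae (Eventually.of_forall fun x => ?_)
    simp only [levyIntegrand, real_inner_smul_right, real_inner_comm ξ x]
    rw [mul_comm Complex.I]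
    push_cast
    field_simp
  rw [truncatedLevy, charFun_conv, charFun_dirac, charFun_compoundPoisson, ← Complex.exp_add, hsplit,
    inner_sub_left]
  congr 1
  push_cast
  ring

end LevyTruncation

/-! ### The shift inequality for finite-dimensional images. -/

section FiniteDimensional

/-- Makes `R - v ⊗ v` a legitimate covariance for the Gaussian part left after splitting off the
direction `v`. -/
lemma isPositive_sub_rankOne {H : Type*} [NormedAddCommGroup H] [InnerProductSpace ℝ H]
    [CompleteSpace H] {R : H →L[ℝ] H} (hR : R.IsPositive) {v : H}
    (hv : ∀ ξ, ⟪v, ξ⟫_ℝ ^ 2 ≤ ⟪ξ, R ξ⟫_ℝ) :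
    (R - InnerProductSpace.rankOne ℝ v v).IsPositive := by
  rw [ContinuousLinearMap.isPositive_def']
  refine ⟨hR.isSelfAdjoint.sub (InnerProductSpace.isPositive_rankOne_self v).isSelfAdjoint,
    fun ξ => ?_⟩
  have := hv ξ
  simp only [ContinuousLinearMap.reApplyInnerSelf_apply, sub_apply,
    InnerProductSpace.rankOne_apply, inner_sub_left, real_inner_smul_left, RCLike.re_to_real]
  rw [real_inner_comm]
  nlinarith

variable {H : Type*} [NormedAddCommGroup H] [InnerProductSpace ℝ H] [CompleteSpace H]
  [MeasurableSpace H] [BorelSpace H]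
  {E : Type*} [NormedAddCommGroup E] [InnerProductSpace ℝ E] [FiniteDimensional ℝ E]
  [MeasurableSpace E] [BorelSpace E]

lemma charFun_map_continuousLinearMap {E : Type*} [NormedAddCommGroup E] [InnerProductSpace ℝ E]
    [CompleteSpace E] [SecondCountableTopology E] [MeasurableSpace E] [BorelSpace E]
    (μ : Measure H) (T : H →L[ℝ] E) (ξ : E) :
    charFun (μ.map T) ξ = charFun μ (T.adjoint ξ) := by
  rw [charFun_apply, integral_map (by fun_prop) (by fun_prop), charFun_apply]
  simp only [ContinuousLinearMap.adjoint_inner_right]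

/-- Image of the standard Gaussian under a positive square root of `Q`. -/
lemma exists_gaussian {Q : E →L[ℝ] E} (hQ : Q.IsPositive) :
    ∃ G : Measure E, IsProbabilityMeasure G ∧
      ∀ ξ, charFun G ξ = Complex.exp (-(1 / 2 : ℂ) * (⟪ξ, Q ξ⟫_ℝ : ℂ)) := by
  obtain ⟨S, hS, hSS⟩ := exists_sqrt hQ
  refine ⟨(stdGaussian E).map S, Measure.isProbabilityMeasure_map (by fun_prop), fun ξ => ?_⟩
  rw [charFun_map_continuousLinearMap, charFun_stdGaussian, ← hSS, hS.isSelfAdjoint.adjoint_eq,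
    mul_apply_eq_comp, ← ContinuousLinearMap.adjoint_inner_left S, hS.isSelfAdjoint.adjoint_eq,
    real_inner_self_eq_norm_sq]
  congr 1
  push_cast
  ring

lemma IsLevyKhintchine.shiftBoundCts_map [SecondCountableTopology H] {μ : Measure H} {a : H}
    {R : H →L[ℝ] H} {m : Measure H} (hμ : IsLevyKhintchine μ a R m) {v : H}
    (hv : ∀ ξ, ⟪v, ξ⟫_ℝ ^ 2 ≤ ⟪ξ, R ξ⟫_ℝ) {α : ℝ} (hα : 1 < α) (c : ℝ) (T : H →L[ℝ] E) :
    ShiftBoundCts α (ENNReal.ofReal (harnackConst α c)) (T (c • v)) (μ.map T) := by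
  have hprob := hμ.isProbabilityMeasure
  have hm := hμ.levyMeasure
  have hQ := (isPositive_sub_rankOne hμ.traceClass.isPositive hv).conj_adjoint T
  obtain ⟨G, hG, hGc⟩ := exists_gaussian hQ
  let L : ℝ →L[ℝ] E := ContinuousLinearMap.toSpanSingleton ℝ (T v)
  let N : Measure E := (gaussianReal 0 1).map L
  have hN : IsProbabilityMeasure N := Measure.isProbabilityMeasure_map (by fun_prop)
  -- `N` is the Gaussian on the line through `T v`, with covariance `T v ⊗ T v`.
  have hNc : ∀ ξ : E, charFun N ξ =
      Complex.exp (-(1 / 2 : ℂ) * ((⟪v, T.adjoint ξ⟫_ℝ ^ 2 : ℝ) : ℂ)) := by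
    intro ξ
    have hL : L.adjoint ξ = ⟪v, T.adjoint ξ⟫_ℝ := by
      have h1 : ⟪(1 : ℝ), L.adjoint ξ⟫_ℝ = ⟪L 1, ξ⟫_ℝ := L.adjoint_inner_right 1 ξ
      have h2 : L 1 = T v := by simp [L]
      rw [h2, ← ContinuousLinearMap.adjoint_inner_right] at h1
      rw [← h1]
      simp
    rw [charFun_map_continuousLinearMap, charFun_gaussianReal, hL]
    congr 1
    push_cast
    ring
  have hNs : ShiftBound α (ENNReal.ofReal (harnackConst α c)) (T (c • v)) N := by
    have h := (shiftBound_gaussianReal hα c).map (L : ℝ →+ E) L.measurable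
    have h2 : L c = T (c • v) := by simp [L]
    rw [← h2]
    exact h
  have hP : ∀ k, IsProbabilityMeasure ((truncatedLevy a m k).map T) := fun k =>
    have := hm.isProbabilityMeasure_truncatedLevy a k
    Measure.isProbabilityMeasure_map (by fun_prop)
  -- Drift and truncated jumps, residual Gaussian, and the Gaussian that absorbs the shift; the two
  -- Gaussian covariances add up to `T R T*`.
  let ν : ℕ → ProbabilityMeasure E := fun k =>
    ⟨(((truncatedLevy a m k).map T).conv G).conv N, inferInstance⟩
  let μT : ProbabilityMeasure E := ⟨μ.map T, Measure.isProbabilityMeasure_map (by fun_prop)⟩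
  have hlim : Tendsto ν atTop (𝓝 μT) := by
    refine ProbabilityMeasure.tendsto_iff_tendsto_charFun.2 fun ξ => ?_
    set η := T.adjoint ξ with hη
    have hνc : ∀ k, charFun (ν k : Measure E) ξ = Complex.exp
        (Complex.I * (⟪a, η⟫_ℝ : ℂ) + (∫ x in outerSet H k, levyIntegrand η x ∂m)
          - (1 / 2 : ℂ) * (⟪η, R η⟫_ℝ : ℂ)) := by
      intro k
      have := hm.isProbabilityMeasure_truncatedLevy a k
      have hq : ⟪ξ, (T ∘L (R - InnerProductSpace.rankOne ℝ v v) ∘L T.adjoint) ξ⟫_ℝ =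
          ⟪η, R η⟫_ℝ - ⟪v, η⟫_ℝ ^ 2 := by
        simp only [ContinuousLinearMap.comp_apply, ← ContinuousLinearMap.adjoint_inner_left,
          sub_apply, InnerProductSpace.rankOne_apply, inner_sub_right,
          real_inner_smul_right, ← hη]
        rw [real_inner_comm η v]
        ring
      change charFun ((((truncatedLevy a m k).map T).conv G).conv N) ξ = _
      rw [charFun_conv, charFun_conv, hNc, hGc, charFun_map_continuousLinearMap, ← hη, hq,
        hm.charFun_truncatedLevy, ← Complex.exp_add, ← Complex.exp_add]
      congr 1
      push_cast
      ring
    change Tendsto _ _ (𝓝 (charFun (μ.map T) ξ))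
    rw [charFun_map_continuousLinearMap, hμ.charFun_eq]
    simp_rw [hνc]
    refine (Complex.continuous_exp.tendsto _).comp ?_
    have h := ((hm.tendsto_setIntegral_levyIntegrand η).const_add
      (Complex.I * (⟪a, η⟫_ℝ : ℂ))).sub_const ((1 / 2 : ℂ) * (⟪η, R η⟫_ℝ : ℂ))
    convert h using 2
    rw [levyExponent, ← hη]
    simp only [levyIntegrand]
    ring
  exact shiftBoundCts_of_tendsto (by linarith) ENNReal.ofReal_ne_top hlim fun k => hNs.conv hα

end FiniteDimensional

/-! ### From finite dimensions to `H`, and from continuous to measurable functions. -/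

section Approximation

variable {H : Type*} [NormedAddCommGroup H]

/-- An increasing sequence of finite-dimensional subspaces with dense union. -/
def denseSpan (H : Type*) [NormedAddCommGroup H] [InnerProductSpace ℝ H]
    [TopologicalSpace.SeparableSpace H] (n : ℕ) : Submodule ℝ H :=
  Submodule.span ℝ (TopologicalSpace.denseSeq H '' Set.Iio n)

instance finiteDimensional_denseSpan [InnerProductSpace ℝ H] [TopologicalSpace.SeparableSpace H]
    (n : ℕ) : FiniteDimensional ℝ (denseSpan H n) :=
  FiniteDimensional.span_of_finite ℝ ((Set.finite_Iio n).image _)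

lemma tendsto_starProjection_denseSpan [InnerProductSpace ℝ H] [CompleteSpace H]
    [TopologicalSpace.SeparableSpace H] (x : H) :
    Tendsto (fun n => (denseSpan H n).starProjection x) atTop (𝓝 x) := by
  refine Submodule.starProjection_tendsto_self (denseSpan H) (fun i j hij => Submodule.span_mono
    (Set.image_mono (Set.Iio_subset_Iio hij))) x ?_
  intro y _
  refine closure_mono ?_ (TopologicalSpace.denseRange_denseSeq H y)
  rintro _ ⟨n, rfl⟩
  exact Submodule.mem_iSup_of_mem (n + 1) (Submodule.subset_span ⟨n, by simp, rfl⟩)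

variable [MeasurableSpace H] [BorelSpace H]

/-- Test each projected law on the restriction of `F` to the subspace; the projections tend strongly
to the identity, and boundedness of `F` gives dominated convergence. -/
lemma shiftBoundCts_of_forall_finiteDimensional [InnerProductSpace ℝ H] [CompleteSpace H]
    [TopologicalSpace.SeparableSpace H] {α : ℝ} {K : ℝ≥0∞} {h : H} {μ : Measure H}
    [IsProbabilityMeasure μ] (hα : 0 ≤ α) (hK : K ≠ ⊤)
    (hμ : ∀ n, ShiftBoundCts α K ((denseSpan H n).orthogonalProjectionOnto h)
      (μ.map (denseSpan H n).orthogonalProjectionOnto)) :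
    ShiftBoundCts α K h μ := by
  intro F
  have key : ∀ n, (∫⁻ z, (F ((denseSpan H n).starProjection (z + h)) : ℝ≥0∞) ∂μ) ^ α ≤
      K * ∫⁻ z, ((bcfRpow F hα) ((denseSpan H n).starProjection z) : ℝ≥0∞) ∂μ := by
    intro n
    have := hμ n (F.compContinuous ⟨Subtype.val, continuous_subtype_val⟩)
    simp only [← ENNReal.coe_rpow_of_nonneg _ hα, BoundedContinuousFunction.compContinuous_apply,
      ContinuousMap.coe_mk] at this
    rw [lintegral_map (Continuous.measurable (by fun_prop)) (by fun_prop),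
      lintegral_map (Continuous.measurable ?_) (by fun_prop)] at this
    · simpa [map_add] using this
    · exact ENNReal.continuous_coe.comp ((bcfRpow F hα).continuous.comp continuous_subtype_val)
  have hlim : ∀ (G : H →ᵇ ℝ≥0) (w : H),
      Tendsto (fun n => ∫⁻ z, (G ((denseSpan H n).starProjection (z + w)) : ℝ≥0∞) ∂μ) atTop
        (𝓝 (∫⁻ z, (G (z + w) : ℝ≥0∞) ∂μ)) := by
    intro G w
    refine tendsto_lintegral_of_dominated_convergence (fun _ => (nndist G 0 : ℝ≥0∞))
      (fun n => Continuous.measurable (by fun_prop)) (fun n => Eventually.of_forall fun z => ?_)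
      (by simp) (Eventually.of_forall fun z => ?_)
    · exact ENNReal.coe_le_coe.2 (BoundedContinuousFunction.NNReal.upper_bound G _)
    · exact ((ENNReal.continuous_coe.comp G.continuous).tendsto _).comp
        (tendsto_starProjection_denseSpan _)
  have h2 := hlim (bcfRpow F hα) 0
  simp only [add_zero] at h2
  have := le_of_tendsto_of_tendsto' ((ENNReal.continuous_rpow_const.tendsto _).comp (hlim F h))
    (ENNReal.Tendsto.const_mul h2 (Or.inr hK)) key
  simpa only [bcfRpow_apply, ENNReal.coe_rpow_of_nonneg _ hα] using this

/-- The `α`-th root of the inequality: a norm bound from `L^α(μ)` to `L¹` of the translate, suited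
to approximation. -/
lemma ShiftBoundCts.eLpNorm_le {α : ℝ} {K : ℝ≥0∞} {h : H} {μ : Measure H} (hα : 1 < α)
    (hμ : ShiftBoundCts α K h μ) (g : H →ᵇ ℝ) :
    eLpNorm g 1 (μ.map (· + h)) ≤ K ^ (1 / α) * eLpNorm g (ENNReal.ofReal α) μ := by
  have hα0 : 0 < α := by linarith
  have h1 := hμ g.nnnorm
  rw [eLpNorm_one_eq_lintegral_enorm, lintegral_map (Continuous.measurable (by fun_prop))
    (by fun_prop), eLpNorm_eq_lintegral_rpow_enorm_toReal (by simpa using hα0) ENNReal.ofReal_ne_top,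
    ENNReal.toReal_ofReal hα0.le, ← ENNReal.mul_rpow_of_nonneg _ _ (by positivity),
    one_div, ENNReal.le_rpow_inv_iff hα0]
  exact h1

/-- Passage from bounded continuous to `L^α` functions. -/
lemma ShiftBoundCts.eLpNorm_le_of_memLp {α : ℝ} {K : ℝ≥0∞} {h : H} {μ : Measure H}
    [IsProbabilityMeasure μ] (hα : 1 < α) (hK : K ≠ ⊤) (hμ : ShiftBoundCts α K h μ) {f : H → ℝ}
    (hf : MemLp f (ENNReal.ofReal α) (μ + μ.map (· + h))) :
    eLpNorm f 1 (μ.map (· + h)) ≤ K ^ (1 / α) * eLpNorm f (ENNReal.ofReal α) μ := by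
  have hα0 : 0 < α := by linarith
  have hα1 : 1 ≤ ENNReal.ofReal α := ENNReal.one_le_ofReal.2 hα.le
  have : IsProbabilityMeasure (μ.map (· + h)) := Measure.isProbabilityMeasure_map (by fun_prop)
  have hle1 : μ ≤ μ + μ.map (· + h) := Measure.le_add_right le_rfl
  have hle2 : μ.map (· + h) ≤ μ + μ.map (· + h) := Measure.le_add_left le_rfl
  have hC : K ^ (1 / α) ≠ ⊤ := ENNReal.rpow_ne_top_of_nonneg (by positivity) hK
  have key : ∀ ε : ℝ≥0∞, ε ≠ 0 → eLpNorm f 1 (μ.map (· + h)) ≤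
      ε + K ^ (1 / α) * (ε + eLpNorm f (ENNReal.ofReal α) μ) := by
    intro ε hε
    -- Approximating in `L^α` of the sum controls the error under `μ` and under its translate at
    -- once, with no absolute continuity between them.
    obtain ⟨g₀, hg, hgL⟩ := hf.exists_boundedContinuous_eLpNorm_sub_le ENNReal.ofReal_ne_top hε
    have hg₁ := hμ.eLpNorm_le hα g₀
    generalize (g₀ : H → ℝ) = g at hg hgL hg₁
    have hfm1 := hf.1.mono_measure hle1
    have hfm2 := hf.1.mono_measure hle2
    have hgm1 := hgL.1.mono_measure hle1
    have hgm2 := hgL.1.mono_measure hle2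
    have e1 : eLpNorm (f - g) 1 (μ.map (· + h)) ≤ ε :=
      ((eLpNorm_le_eLpNorm_of_exponent_le hα1 (hfm2.sub hgm2)).trans
        (eLpNorm_mono_measure _ hle2)).trans hg
    have e2 : eLpNorm g (ENNReal.ofReal α) μ ≤ ε + eLpNorm f (ENNReal.ofReal α) μ := by
      have e3 : eLpNorm (g - f) (ENNReal.ofReal α) μ ≤ ε := by
        rw [eLpNorm_sub_comm]
        exact (eLpNorm_mono_measure _ hle1).trans hg
      have e4 := eLpNorm_add_le (hgm1.sub hfm1) hfm1 hα1
      rw [sub_add_cancel] at e4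
      exact e4.trans (by gcongr)
    have e5 := eLpNorm_add_le (hfm2.sub hgm2) hgm2 le_rfl
    rw [sub_add_cancel] at e5
    refine e5.trans (add_le_add e1 (hg₁.trans ?_))
    gcongr
  -- Finiteness of `K ^ (1 / α)` is what allows `ε → 0`.
  have hcont : Continuous fun ε : ℝ≥0∞ =>
      ε + K ^ (1 / α) * (ε + eLpNorm f (ENNReal.ofReal α) μ) :=
    continuous_id.add ((ENNReal.continuous_const_mul hC).comp (continuous_id.add continuous_const))
  have hlim := (hcont.tendsto 0).mono_left (nhdsWithin_le_nhds (s := Set.Ioi 0))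
  simp only [zero_add] at hlim
  refine ge_of_tendsto hlim ?_
  filter_upwards [self_mem_nhdsWithin] with ε hε
  exact key ε (ne_of_gt hε)

lemma ShiftBoundCts.integral_rpow_le {α : ℝ} {C : ℝ} {h : H} {μ : Measure H}
    [IsProbabilityMeasure μ] (hα : 1 < α) (hC : 0 ≤ C)
    (hμ : ShiftBoundCts α (ENNReal.ofReal C) h μ) {f : H → ℝ} (hf : Measurable f)
    (hf0 : ∀ x, 0 ≤ f x) {B : ℝ} (hfB : ∀ x, f x ≤ B) :
    (∫ z, f (z + h) ∂μ) ^ α ≤ C * ∫ z, f z ^ α ∂μ := by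
  have hα0 : 0 < α := by linarith
  have : IsProbabilityMeasure (μ.map (· + h)) := Measure.isProbabilityMeasure_map (by fun_prop)
  have hL := hμ.eLpNorm_le_of_memLp hα ENNReal.ofReal_ne_top
    (MemLp.of_bound hf.aestronglyMeasurable B (Eventually.of_forall fun x => by
      rw [Real.norm_of_nonneg (hf0 x)]; exact hfB x))
  rw [eLpNorm_one_eq_lintegral_enorm, lintegral_map (by fun_prop)
    (by fun_prop), eLpNorm_eq_lintegral_rpow_enorm_toReal (by simpa using hα0) ENNReal.ofReal_ne_top,
    ENNReal.toReal_ofReal hα0.le, ← ENNReal.mul_rpow_of_nonneg _ _ (by positivity),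
    one_div, ENNReal.le_rpow_inv_iff hα0] at hL
  simp only [Real.enorm_of_nonneg (hf0 _), ENNReal.ofReal_rpow_of_nonneg (hf0 _) hα0.le] at hL
  have i1 : Integrable (fun z => f (z + h)) μ :=
    (integrable_const B).mono' (Measurable.aestronglyMeasurable (by fun_prop)) (Eventually.of_forall fun x => by
      rw [Real.norm_of_nonneg (hf0 _)]; exact hfB _)
  have i2 : Integrable (fun z => f z ^ α) μ :=
    (integrable_const (B ^ α)).mono' (hf.pow_const α).aestronglyMeasurable (Eventually.of_forall fun x => by
      rw [Real.norm_of_nonneg (Real.rpow_nonneg (hf0 _) _)]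
      exact Real.rpow_le_rpow (hf0 _) (hfB _) hα0.le)
  have n1 : 0 ≤ ∫ z, f (z + h) ∂μ := integral_nonneg fun z => hf0 _
  have n2 : 0 ≤ ∫ z, f z ^ α ∂μ := integral_nonneg fun z => Real.rpow_nonneg (hf0 _) _
  rw [← ofReal_integral_eq_lintegral_ofReal i1 (Eventually.of_forall fun z => hf0 _),
    ← ofReal_integral_eq_lintegral_ofReal i2
      (Eventually.of_forall fun z => Real.rpow_nonneg (hf0 _) _),
    ENNReal.ofReal_rpow_of_nonneg n1 hα0.le, ← ENNReal.ofReal_mul hC] at hL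
  exact (ENNReal.ofReal_le_ofReal_iff (mul_nonneg hC n2)).1 hL

end Approximation

/-! ### The Cameron–Martin direction and the conclusion. -/

/-- The vector `v = R^{1/2} g / |g|` satisfies `v ⊗ v ≤ R`. -/
lemma exists_inner_sq_le {H : Type*} [NormedAddCommGroup H] [InnerProductSpace ℝ H]
    [CompleteSpace H] {R : H →L[ℝ] H} (hR : R.IsPositive) (g : H) :
    ∃ v : H, opSqrt R g = ‖g‖ • v ∧ ∀ ξ, ⟪v, ξ⟫_ℝ ^ 2 ≤ ⟪ξ, R ξ⟫_ℝ := by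
  have hS := opSqrt_isPositive hR
  -- For `g = 0` the convention `0⁻¹ = 0` gives `v = 0`, which still works.
  refine ⟨‖g‖⁻¹ • opSqrt R g, ?_, fun ξ => ?_⟩
  · rcases eq_or_ne g 0 with rfl | hg
    · simp
    · rw [smul_smul, mul_inv_cancel₀ (norm_ne_zero_iff.2 hg), one_smul]
  · have h1 : ⟪‖g‖⁻¹ • opSqrt R g, ξ⟫_ℝ = ⟪‖g‖⁻¹ • g, opSqrt R ξ⟫_ℝ := by
      rw [real_inner_smul_left, real_inner_smul_left,
        ← ContinuousLinearMap.adjoint_inner_right, hS.isSelfAdjoint.adjoint_eq]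
    have h2 : ⟪ξ, R ξ⟫_ℝ = ‖opSqrt R ξ‖ ^ 2 := by
      nth_rewrite 1 [← opSqrt_mul_self hR]
      rw [mul_apply_eq_comp, ← ContinuousLinearMap.adjoint_inner_left,
        hS.isSelfAdjoint.adjoint_eq, real_inner_self_eq_norm_sq]
    have h3 : ‖‖g‖⁻¹ • g‖ ≤ 1 := by
      rw [norm_smul, norm_inv, norm_norm]
      exact inv_mul_le_one
    rw [h1, h2, ← sq_abs]
    gcongr
    exact (abs_real_inner_le_norm _ _).trans (mul_le_of_le_one_left (norm_nonneg _) h3)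

lemma IsLevyKhintchine.shiftBoundCts {H : Type*} [NormedAddCommGroup H] [InnerProductSpace ℝ H]
    [CompleteSpace H] [TopologicalSpace.SeparableSpace H] [MeasurableSpace H] [BorelSpace H]
    {μ : Measure H} {a : H} {R : H →L[ℝ] H} {m : Measure H} (hμ : IsLevyKhintchine μ a R m)
    {α : ℝ} (hα : 1 < α) (g : H) :
    ShiftBoundCts α (ENNReal.ofReal (harnackConst α ‖g‖)) (opSqrt R g) μ := by
  have := hμ.isProbabilityMeasure
  have : SecondCountableTopology H := UniformSpace.secondCountable_of_separable H
  obtain ⟨v, hgv, hv⟩ := exists_inner_sq_le hμ.traceClass.isPositive g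
  rw [hgv]
  exact shiftBoundCts_of_forall_finiteDimensional (by linarith) ENNReal.ofReal_ne_top
    fun n => hμ.shiftBoundCts_map hv hα ‖g‖ _

end Mehler

theorem mainTheorem2 {H : Type*} [NormedAddCommGroup H] [InnerProductSpace ℝ H]
    [CompleteSpace H] [TopologicalSpace.SeparableSpace H] [MeasurableSpace H] [BorelSpace H]
    (U : ℝ → ℝ → H →L[ℝ] H) (hU : Mehler.IsEvolutionFamily U)
    (μ : ℝ → ℝ → Measure H) (hμ : Mehler.IsSkewConvolution U μ)
    (a : ℝ → ℝ → H) (R : ℝ → ℝ → H →L[ℝ] H) (m : ℝ → ℝ → Measure H)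
    (hD : ∀ s t, s ≤ t → Mehler.IsLevyKhintchine (μ t s) (a t s) (R t s) (m t s))
    (α : ℝ) (hα : 1 < α) (s t : ℝ) (hst : s ≤ t)
    (f : H → ℝ) (hf : Measurable f) (hf_nonneg : ∀ x, 0 ≤ f x) (hf_bdd : ∃ C, ∀ x, f x ≤ C)
    (x y : H) :
    ((Mehler.mehlerOp U μ s t f x ^ α : ℝ) : EReal) ≤
      Mehler.harnackBound α (Mehler.gammaNorm (R t s) (U t s) (x - y))
        (Mehler.mehlerOp U μ s t (fun z => f z ^ α) y) := by
  by_cases hx : x - y ∈ Mehler.gammaDomain (R t s) (U t s)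
  · set g := Mehler.gamma (R t s) (U t s) (x - y)
    have hg : Mehler.opSqrt (R t s) g = U t s (x - y) := Mehler.apply_pseudoInv hx
    obtain ⟨B, hB⟩ := hf_bdd
    have hLK := hD s t hst
    have := hLK.isProbabilityMeasure
    rw [Mehler.gammaNorm, if_pos hx, Mehler.harnackBound, if_neg ENNReal.ofReal_ne_top,
      ENNReal.toReal_ofReal (norm_nonneg _), EReal.coe_le_coe_iff]
    -- With the test function recentred at `U(t,s) y`, the shift by `R^{1/2} g = U(t,s)(x - y)`
    -- turns `y` into `x`.
    have h := (hLK.shiftBoundCts hα g).integral_rpow_le hα (Real.exp_nonneg _)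
      (f := fun z => f (U t s y + z)) (by fun_prop) (fun _ => hf_nonneg _) (fun _ => hB _)
    have hshift : ∀ z, U t s y + (z + U t s (x - y)) = U t s x + z := fun z => by
      rw [map_sub]; abel
    rw [hg] at h
    simp only [hshift] at h
    exact h
  · rw [Mehler.gammaNorm, if_neg hx, Mehler.harnackBound, if_pos rfl]
    exact le_top
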